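/- For a real number $\beta>1$, the $(-\beta)$-transformation is the map $T_{-\beta}$ of $\big[\frac{-\beta}{\beta+1},\frac{1}{\beta+1}\big)$ into itself given by $T_{-\beta}(x)=-\beta x-\big\lfloor \frac{\beta}{\beta+1}-\beta x\big\rfloor$. The $(-\beta)$-expansion of a point $x$ of this interval is the sequence $a_1a_2\cdots$ of integers $a_n=\big\lfloor \frac{\beta}{\beta+1}-\beta\,T_{-\beta}^{n-1}(x)\big\rfloor$, $n\ge 1$. The set of $(-\beta)$-integers is $\mathbb{Z}_{-\beta}=\bigcup_{n\ge 0}(-\beta)^n\,T_{-\beta}^{-n}(0)$, where $T_{-\beta}^{-n}(0)$ is the set of all $y$ in this interval with $T_{-\beta}^n(y)=0$. A set $S\subset\mathbb{R}$ is uniformly discrete if there is $r>0$ such that every interval of length $r$ contains at most one point of $S$. **Proposition.** The morphism $\sigma_1:\ 3\mapsto 30032,\ 2\mapsto 2,\ 0\mapsto 00$ on words over the alphabet $\{0,2,3\}$ has exactly one fixed point $a_1a_2\cdots = 30032\,00\,00\,30032\,2\cdots$ among the infinite words that start with the letter $3$. For this word there exists $\beta>1$ such that 1. $a_1a_2\cdots$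 is the $(-\beta)$-expansion of $\frac{-\beta}{\beta+1}$; 2. the set $P=\big\{T_{-\beta}^{2n-1}\big(\frac{-\beta}{\beta+1}\big)\ \big|\ n\ge 1,\ T_{-\beta}^{2n-1}\big(\frac{-\beta}{\beta+1}\big)>0\big\}$ is non-empty with $\inf P=0$, so that $0$ is an accumulation point of $P$; 3. $\mathbb{Z}_{-\beta}$ is uniformly discrete. In particular, $\mathbb{Z}_{-\beta}$ can be uniformly discrete although $0$ is an accumulation point of $P$; that is, the converse of the implication "if $0$ is not an accumulation point of $P$, then $\mathbb{Z}_{-\beta}$ is uniformly discrete" fails. -/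

import Mathlib

namespace NegBeta

noncomputable section

/-- The domain `[-β/(β+1), 1/(β+1))` of the `(-β)`-transformation. -/
def domain (β : ℝ) : Set ℝ := Set.Ico (-β / (β + 1)) (1 / (β + 1))

/-- The `(-β)`-transformation `x ↦ -β x - ⌊β/(β+1) - β x⌋`. The formula is written for all real `x`;
it is only ever used on `domain β`, which it maps into itself. -/
def T (β x : ℝ) : ℝ := -β * x - (⌊β / (β + 1) - β * x⌋ : ℝ)

theorem T_mapsTo {β : ℝ} (hβ : 1 < β) : Set.MapsTo (T β) (domain β) (domain β) := by
  intro x _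
  have h1 := Int.floor_le (β / (β + 1) - β * x)
  have h2 := Int.lt_floor_add_one (β / (β + 1) - β * x)
  have h3 : 1 / (β + 1) = 1 - β / (β + 1) := by
    field_simp
    ring
  have h4 : -β / (β + 1) = -(β / (β + 1)) := neg_div _ _
  unfold domain T
  rw [Set.mem_Ico, h3, h4]
  constructor <;> linarith

/-- The left endpoint `-β/(β+1)` of the domain. -/
def leftEnd (β : ℝ) : ℝ := -β / (β + 1)

/-- The digits of the `(-β)`-expansion of `x`: the digit at index `n` (counted from `0`) is the integer
subtracted when `T β` is applied to `T^n x`. -/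
def expansion (β x : ℝ) (n : ℕ) : ℤ := ⌊β / (β + 1) - β * (T β)^[n] x⌋

/-- The set of `(-β)`-integers, the union over `n ≥ 0` of `(-β)^n T^{-n}(0)`, where `T^{-n}(0)` is the
preimage of `0` in the domain of the transformation. -/
def negBetaIntegers (β : ℝ) : Set ℝ :=
  ⋃ n : ℕ, (fun y : ℝ => (-β) ^ n * y) '' {y | y ∈ domain β ∧ (T β)^[n] y = 0}

/-- The set of the positive numbers among `T^{2n-1}(-β/(β+1))`, `n ≥ 1`. -/
def positiveOddOrbit (β : ℝ) : Set ℝ :=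
  {x | 0 < x ∧ ∃ n : ℕ, 1 ≤ n ∧ x = (T β)^[2 * n - 1] (leftEnd β)}

/-- There is `r > 0` such that every interval of length `r` contains at most one point of `S`. -/
def UniformlyDiscrete (S : Set ℝ) : Prop :=
  ∃ r : ℝ, 0 < r ∧ ∀ x : ℝ, (S ∩ Set.Icc x (x + r)).Subsingleton

end

/-- The alphabet `{0, 2, 3}`. -/
inductive Letter where
  | zero : Letter
  | two : Letter
  | three : Letter

/-- The integer denoted by a letter. -/
def Letter.val : Letter → ℤ
  | .zero => 0
  | .two => 2
  | .three => 3

/-- The images of the letters: `3 ↦ 30032`, `2 ↦ 2`, `0 ↦ 00`. -/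
def sigmaLetter : Letter → List Letter
  | .three => [.three, .zero, .zero, .three, .two]
  | .two => [.two]
  | .zero => [.zero, .zero]

/-- The morphism on finite words determined by `sigmaLetter`. -/
def sigma (w : List Letter) : List Letter := w.flatMap sigmaLetter

/-- The finite word `w` is a prefix of the infinite word `a`. -/
def IsPrefix (w : List Letter) (a : ℕ → Letter) : Prop :=
  ∀ (i : ℕ) (h : i < w.length), w[i] = a i

/-- The infinite word `a` (indexed from `0`) is a fixed point of `sigma`: the image of every finite
prefix of `a` is a prefix of `a`. Since `sigma` erases no letter, these images are arbitrarily long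
prefixes of the infinite word `sigma a`, so this says that `sigma a = a`. -/
def IsFixedPoint (a : ℕ → Letter) : Prop :=
  ∀ n : ℕ, IsPrefix (sigma ((List.range n).map a)) a

end NegBeta

/-! ### Combinatorics of the fixed word -/

namespace NegBeta

/-! Put `w k = iterThree k`. Then `w (k+1) = w k · 0^(2^(k+1)) · w k · 2`, and every `w k` has odd
length. This recursion determines the fixed word and supplies all the combinatorics (`IsRuler`).

The intermediate value theorem gives `β` between 18/5 and 4 for which the word has value `leftEnd β`
in base `-β`. Let `t n` be the value of its `n`-th tail. All `t n` lie in the domain, since a later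
`3` starts a copy of the word that agrees with it for an odd number of letters and then has `2`
against `0` (`leftEnd_lt`). Hence the word is the expansion and `t n` is the orbit of the left
endpoint. Odd positions followed by long odd runs of `0` and then a `3` give arbitrarily small
positive `t n`.

For discreteness, two points of `T^{-n}(0)` are followed until their digits differ; their gap is
then bounded below by the distance from a preimage of `0` to the left endpoint. The crux is
`le_pow_mul_sub_leftEnd`: for `z` in `T^{-k}(0)`, that distance times `β^k` is at least 1/10. Small
orbit values could only spoil this if `z` followed the word for `k` digits with `a k = 0`; parity
and the copies of the word exclude that (`le_of_digits_eq`). -/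

theorem sigma_append (u v : List Letter) : sigma (u ++ v) = sigma u ++ sigma v :=
  List.flatMap_append

theorem sigma_replicate_zero (n : ℕ) :
    sigma (List.replicate n .zero) = List.replicate (2 * n) .zero := by
  induction n with
  | zero => rfl
  | succ n ih =>
    have h : 2 * (n + 1) = 2 + 2 * n := by ring
    rw [List.replicate_succ', sigma_append, ih, h, Nat.add_comm, List.replicate_add]
    rfl

/-- The iterated image of the letter `3`. -/
def iterThree (k : ℕ) : List Letter := sigma^[k] [.three]

theorem iterThree_succ' (k : ℕ) : iterThree (k + 1) = sigma (iterThree k) :=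
  Function.iterate_succ_apply' _ _ _

/-- The case `k = 0` is `3 · 00 · 3 · 2`; applying `sigma` doubles the block of zeros and fixes the
final `2`. -/
theorem iterThree_succ (k : ℕ) :
    iterThree (k + 1) =
      iterThree k ++ (List.replicate (2 ^ (k + 1)) .zero ++ (iterThree k ++ [.two])) := by
  induction k with
  | zero => rfl
  | succ k ih =>
    conv_lhs => rw [iterThree_succ', ih]
    simp only [sigma_append, sigma_replicate_zero, ← iterThree_succ']
    rw [pow_succ 2 (k + 1), Nat.mul_comm (2 ^ (k + 1)) 2]
    rfl

/-- The length of the iterated image of the letter `3`. -/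
def iterLength (k : ℕ) : ℕ := (iterThree k).length

theorem iterLength_zero : iterLength 0 = 1 := rfl

theorem iterLength_succ (k : ℕ) :
    iterLength (k + 1) = iterLength k + 2 ^ (k + 1) + iterLength k + 1 := by
  simp only [iterLength, iterThree_succ k, List.length_append, List.length_replicate,
    List.length_singleton]
  ring

theorem iterLength_lt_succ (k : ℕ) : iterLength k < iterLength (k + 1) := by
  rw [iterLength_succ, Nat.add_assoc, Nat.add_assoc]
  exact Nat.lt_add_of_pos_right (by positivity)

theorem lt_iterLength (k : ℕ) : k < iterLength k := by
  induction k with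
  | zero => decide
  | succ k ih => exact lt_of_le_of_lt ih (iterLength_lt_succ k)

theorem iterLength_odd (k : ℕ) : iterLength k % 2 = 1 := by
  cases k with
  | zero => rfl
  | succ k => rw [iterLength_succ, pow_succ]; omega

theorem isPrefix_append {u v : List Letter} {a : ℕ → Letter} :
    IsPrefix (u ++ v) a ↔ IsPrefix u a ∧ IsPrefix v (fun i => a (u.length + i)) := by
  constructor
  · intro h
    refine ⟨fun i hi => ?_, fun i hi => ?_⟩
    · rw [← h i (by simp; omega), List.getElem_append_left hi]
    · have := h (u.length + i) (by simp; omega)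
      rw [List.getElem_append_right (by omega)] at this
      simpa using this
  · rintro ⟨h1, h2⟩ i hi
    rcases lt_or_ge i u.length with hu | hu
    · rw [List.getElem_append_left hu, h1]
    · rw [List.getElem_append_right hu, h2]
      exact congrArg a (Nat.add_sub_cancel' hu)

theorem isPrefix_iff_eq_map {w : List Letter} {a : ℕ → Letter} :
    IsPrefix w a ↔ w = (List.range w.length).map a := by
  constructor
  · intro h
    apply List.ext_getElem (by simp)
    intro i h1 h2
    simp [h i h1]
  · intro h i hi
    have : w[i] = ((List.range w.length).map a)[i]'(by simpa using hi) := by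
      congr 1
    simpa using this

theorem IsFixedPoint.isPrefix_iterThree {a : ℕ → Letter} (h0 : a 0 = .three)
    (ha : IsFixedPoint a) (k : ℕ) : IsPrefix (iterThree k) a := by
  induction k with
  | zero =>
    intro i hi
    have : i = 0 := Nat.lt_one_iff.mp hi
    subst this
    exact h0.symm
  | succ k ih =>
    rw [iterThree_succ', isPrefix_iff_eq_map.mp ih]
    exact ha _

/-- The fixed point of `sigma` that starts with the letter `3`. -/
def fixedWord (n : ℕ) : Letter := (iterThree n)[n]'(lt_iterLength n)

theorem iterThree_prefix {j k : ℕ} (h : j ≤ k) : iterThree j <+: iterThree k := by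
  induction k, h using Nat.le_induction with
  | base => exact List.prefix_rfl
  | succ k _ ih =>
    rw [iterThree_succ k]
    exact ih.trans (List.prefix_append _ _)

theorem isPrefix_iterThree_fixedWord (k : ℕ) : IsPrefix (iterThree k) fixedWord := by
  intro i hi
  unfold fixedWord
  rcases le_total i k with h | h
  · exact ((iterThree_prefix h).getElem (lt_iterLength i)).symm
  · exact (iterThree_prefix h).getElem hi

theorem isFixedPoint_fixedWord : IsFixedPoint fixedWord := by
  intro n
  have h := isPrefix_iterThree_fixedWord n
  have h1 : iterThree n = (List.range n).map fixedWord ++ (iterThree n).drop n := by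
    conv_lhs => rw [← List.take_append_drop n (iterThree n)]
    congr 1
    conv_lhs => rw [isPrefix_iff_eq_map.mp h]
    rw [← List.map_take, List.take_range, min_eq_left]
    exact (lt_iterLength n).le
  have h2 := isPrefix_iterThree_fixedWord (n + 1)
  rw [iterThree_succ', h1, sigma_append] at h2
  exact (isPrefix_append.mp h2).1

theorem existsUnique_fixedPoint :
    ∃! a : ℕ → Letter, a 0 = .three ∧ IsFixedPoint a := by
  refine ⟨fixedWord, ⟨rfl, isFixedPoint_fixedWord⟩, ?_⟩
  rintro a ⟨h0, ha⟩
  funext n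
  exact (ha.isPrefix_iterThree h0 n n (lt_iterLength n)).symm

/-- `a = w 0^{2^(k+1)} w 2 ⋯` for every iterated image `w` of the letter `3`. -/
structure IsRuler (a : ℕ → Letter) : Prop where
  head : a 0 = .three
  zeros : ∀ k i, i < 2 ^ (k + 1) → a (iterLength k + i) = .zero
  copy : ∀ k i, i < iterLength k → a (iterLength k + 2 ^ (k + 1) + i) = a i
  last : ∀ k, a (iterLength k + 2 ^ (k + 1) + iterLength k) = .two

theorem IsFixedPoint.isRuler {a : ℕ → Letter} (h0 : a 0 = .three) (ha : IsFixedPoint a) :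
    IsRuler a := by
  have h : ∀ k, _ := fun k => by
    have h1 := ha.isPrefix_iterThree h0 (k + 1)
    rw [iterThree_succ, isPrefix_append, isPrefix_append, isPrefix_append] at h1
    simp only [List.length_replicate] at h1
    exact h1
  refine ⟨h0, fun k i hi => ?_, fun k i hi => ?_, fun k => ?_⟩
  · have := (h k).2.1 i (by simpa using hi)
    simpa [iterLength] using this.symm
  · have h1 := (h k).2.2.1 i hi
    have h2 := (h k).1 i hi
    rw [h2] at h1
    rw [h1, Nat.add_assoc]
    rfl
  · have := (h k).2.2.2 0 (by simp)
    simpa [iterLength, Nat.add_assoc] using this.symm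

/-- The four ways in which a position of `w 0^{2^(k+1)} w 2` can lie. -/
theorem lt_iterLength_succ_cases {n k : ℕ} (h : n < iterLength (k + 1)) :
    n < iterLength k ∨ (∃ i < 2 ^ (k + 1), n = iterLength k + i) ∨
      (∃ i < iterLength k, n = iterLength k + 2 ^ (k + 1) + i) ∨
      n = iterLength k + 2 ^ (k + 1) + iterLength k := by
  rw [iterLength_succ] at h
  by_cases h1 : n < iterLength k
  · exact .inl h1
  by_cases h2 : n < iterLength k + 2 ^ (k + 1)
  · exact .inr (.inl ⟨n - iterLength k, by omega, by omega⟩)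
  by_cases h3 : n < iterLength k + 2 ^ (k + 1) + iterLength k
  · exact .inr (.inr (.inl ⟨n - (iterLength k + 2 ^ (k + 1)), by omega, by omega⟩))
  · exact .inr (.inr (.inr (by omega)))

namespace IsRuler

variable {a : ℕ → Letter}

theorem eq_zero_of_succ_eq_three (ha : IsRuler a) {n : ℕ} (hn : a (n + 1) = .three) :
    a n = .zero := by
  -- Statements about positions are proved inside each `iterThree k`, by induction on `k`, so that
  -- they transfer to the second copy.
  have key : ∀ k n, n + 1 < iterLength k → a (n + 1) = .three → a n = .zero := by
    intro k
    induction k with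
    | zero => intro n h; simp [iterLength_zero] at h
    | succ k ih =>
      intro n h hn
      rcases lt_iterLength_succ_cases h with h | ⟨i, hi, h⟩ | ⟨i, hi, h⟩ | h
      · exact ih n h hn
      · rw [h, ha.zeros k i hi] at hn; cases hn
      · cases i with
        | zero =>
          have hp : 0 < 2 ^ (k + 1) := by positivity
          have := ha.zeros k (2 ^ (k + 1) - 1) (by omega)
          rwa [show iterLength k + (2 ^ (k + 1) - 1) = n by omega] at this
        | succ i =>
          rw [h, ha.copy k _ hi] at hn
          rw [show n = iterLength k + 2 ^ (k + 1) + i by omega, ha.copy k i (by omega)]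
          exact ih i hi hn
      · rw [h, ha.last] at hn; cases hn
  exact key (n + 1) n (lt_iterLength _) hn

theorem exists_zeros_then_three (ha : IsRuler a) {n : ℕ} (hn : a n = .zero) :
    ∃ R, (∀ i < R, a (n + i) = .zero) ∧ a (n + R) = .three := by
  have key : ∀ k n, n < iterLength k → a n = .zero →
      ∃ R, n + R < iterLength k ∧ (∀ i < R, a (n + i) = .zero) ∧ a (n + R) = .three := by
    intro k
    induction k with
    | zero =>
      intro n h hn
      rw [iterLength_zero, Nat.lt_one_iff] at h
      rw [h, ha.head] at hn; cases hn
    | succ k ih =>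
      intro n h hn
      rcases lt_iterLength_succ_cases h with h | ⟨i, hi, h⟩ | ⟨i, hi, h⟩ | h
      · obtain ⟨R, h1, h2⟩ := ih n h hn
        exact ⟨R, h1.trans (iterLength_lt_succ k), h2⟩
      · refine ⟨2 ^ (k + 1) - i, ?_, fun l hl => ?_, ?_⟩
        · have := lt_iterLength k
          rw [iterLength_succ]; omega
        · rw [h, Nat.add_assoc]; exact ha.zeros k _ (by omega)
        · rw [← ha.head, ← ha.copy k 0 (by have := lt_iterLength k; omega)]
          congr 1; omega
      · rw [h, ha.copy k i hi] at hn
        obtain ⟨R, h1, h2, h3⟩ := ih i hi hn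
        refine ⟨R, by rw [iterLength_succ]; omega, fun l hl => ?_, ?_⟩
        · rw [h, Nat.add_assoc, ha.copy k _ (by omega)]; exact h2 l hl
        · rw [h, Nat.add_assoc, ha.copy k _ h1]; exact h3
      · rw [h, ha.last] at hn; cases hn
  obtain ⟨R, -, h⟩ := key n n (lt_iterLength n) hn
  exact ⟨R, h⟩

/-- The innermost second copy that starts at `n` is some `iterThree k`, of odd length. It is
followed by `2`, whereas the initial copy is followed by `0`. -/
theorem exists_odd_agreement (ha : IsRuler a) {n : ℕ} (hn0 : n ≠ 0) (hn : a n = .three) :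
    ∃ M, M % 2 = 1 ∧ (∀ i < M, a (n + i) = a i) ∧ a (n + M) = .two ∧ a M = .zero := by
  have key : ∀ k n, n < iterLength k → n ≠ 0 → a n = .three → ∃ M, n + M < iterLength k ∧
      M % 2 = 1 ∧ (∀ i < M, a (n + i) = a i) ∧ a (n + M) = .two ∧ a M = .zero := by
    intro k
    induction k with
    | zero =>
      intro n h hn
      rw [iterLength_zero, Nat.lt_one_iff] at h
      exact absurd h hn
    | succ k ih =>
      intro n h hn0 hn
      rcases lt_iterLength_succ_cases h with h | ⟨i, hi, h⟩ | ⟨i, hi, h⟩ | h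
      · obtain ⟨M, h1, h2⟩ := ih n h hn0 hn
        exact ⟨M, h1.trans (iterLength_lt_succ k), h2⟩
      · rw [h, ha.zeros k i hi] at hn; cases hn
      · rcases Nat.eq_zero_or_pos i with rfl | hi0
        · refine ⟨iterLength k, by rw [iterLength_succ]; omega, iterLength_odd k, ?_, ?_, ?_⟩
          · intro i hi; rw [h]; exact ha.copy k i hi
          · rw [h]; exact ha.last k
          · exact ha.zeros k 0 (by positivity)
        · rw [h, ha.copy k i hi] at hn
          obtain ⟨M, h1, h2, h3, h4, h5⟩ := ih i hi hi0.ne' hn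
          refine ⟨M, by rw [iterLength_succ]; omega, h2, fun l hl => ?_, ?_, h5⟩
          · rw [h, Nat.add_assoc, ha.copy k _ (by omega)]; exact h3 l hl
          · rw [h, Nat.add_assoc, ha.copy k _ h1]; exact h4
      · rw [h, ha.last] at hn; cases hn
  obtain ⟨M, -, h⟩ := key n n (lt_iterLength n) hn0 hn
  exact ⟨M, h⟩

/-- Second copies start at odd positions. A `3` at an even position other than 0 therefore lies
strictly inside one, once `k` is minimal with `n` in `iterThree (k+1)`. -/
theorem exists_odd_copy (ha : IsRuler a) {n : ℕ} (hn0 : n ≠ 0) (hne : n % 2 = 0)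
    (hn : a n = .three) :
    ∃ q < n, q % 2 = 1 ∧ ∀ i, q + i ≤ n → a (q + i) = a i := by
  have key : ∀ k n, n < iterLength k → n ≠ 0 → n % 2 = 0 → a n = .three →
      ∃ q < n, q % 2 = 1 ∧ ∀ i, q + i ≤ n → a (q + i) = a i := by
    intro k
    induction k with
    | zero =>
      intro n h hn
      rw [iterLength_zero, Nat.lt_one_iff] at h
      exact absurd h hn
    | succ k ih =>
      intro n h hn0 hne hn
      rcases lt_iterLength_succ_cases h with h | ⟨i, hi, h⟩ | ⟨i, hi, h⟩ | h
      · exact ih n h hn0 hne hn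
      · rw [h, ha.zeros k i hi] at hn; cases hn
      · have h1 := iterLength_odd k
        have h2 : 2 ^ (k + 1) % 2 = 0 := by rw [pow_succ]; omega
        exact ⟨iterLength k + 2 ^ (k + 1), by omega, by omega,
          fun l hl => ha.copy k l (by omega)⟩
      · rw [h, ha.last] at hn; cases hn
  exact key n n (lt_iterLength n) hn0 hne hn

theorem exists_odd_zeros_then_three (ha : IsRuler a) (k : ℕ) :
    ∃ m R, m % 2 = 1 ∧ R % 2 = 1 ∧ k < R ∧ (∀ i < R, a (m + i) = .zero) ∧
      a (m + R) = .three := by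
  have h1 := iterLength_odd k
  have h2 := iterLength_odd (k + 1)
  have h3 : 2 ^ (k + 1) = 2 * 2 ^ k := by ring
  have h4 : 2 ^ (k + 1 + 1) = 2 * 2 ^ (k + 1) := by ring
  have h5 : k < 2 ^ k := Nat.lt_two_pow_self
  have h6 := lt_iterLength k
  have h7 := iterLength_succ k
  -- The block `0^(2^(k+1))` starts at an odd position, and at an even one in the shifted copy;
  -- dropping its first zero makes both the start and the remaining length odd.
  refine ⟨iterLength (k + 1) + 2 ^ (k + 1 + 1) + (iterLength k + 1), 2 ^ (k + 1) - 1,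
    by omega, by omega, by omega, fun i hi => ?_, ?_⟩
  · rw [Nat.add_assoc, ha.copy (k + 1) _ (by omega), Nat.add_assoc]
    exact ha.zeros k _ (by omega)
  · rw [Nat.add_assoc, ha.copy (k + 1) _ (by omega), ← ha.head, ← ha.copy k 0 (by omega)]
    congr 1; omega

end IsRuler

end NegBeta

/-! ### The base, and the orbit of the left endpoint -/

namespace NegBeta

theorem Letter.val_nonneg (x : Letter) : (0 : ℝ) ≤ (x.val : ℝ) := by
  cases x <;> norm_num [Letter.val]

theorem Letter.val_le_three (x : Letter) : (x.val : ℝ) ≤ 3 := by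
  cases x <;> norm_num [Letter.val]

/-- The value in base `-β` of the word `a n, a (n + 1), …`. -/
noncomputable def tailValue (a : ℕ → Letter) (β : ℝ) (n : ℕ) : ℝ :=
  ∑' k, ((a (n + k)).val : ℝ) * (-β⁻¹) ^ (k + 1)

theorem norm_tailValue_term_le (a : ℕ → Letter) {b β : ℝ} (hb : 0 < b) (h : b ≤ β) (n k : ℕ) :
    ‖((a (n + k)).val : ℝ) * (-β⁻¹) ^ (k + 1)‖ ≤ 3 * b⁻¹ * b⁻¹ ^ k := by
  rw [norm_mul, norm_pow, norm_neg, Real.norm_of_nonneg (Letter.val_nonneg _),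
    Real.norm_of_nonneg (inv_nonneg.2 (hb.le.trans h)), mul_assoc, ← pow_succ']
  have h1 : β⁻¹ ≤ b⁻¹ := inv_anti₀ hb h
  have h2 : 0 ≤ β⁻¹ := inv_nonneg.2 (hb.le.trans h)
  exact mul_le_mul (Letter.val_le_three _) (pow_le_pow_left₀ h2 h1 _) (by positivity) (by norm_num)

theorem hasSum_three_mul_inv_geometric {b : ℝ} (hb : 1 < b) :
    HasSum (fun k : ℕ => 3 * b⁻¹ * b⁻¹ ^ k) (3 / (b - 1)) := by
  have h := (hasSum_geometric_of_lt_one (inv_nonneg.2 (by linarith)) (inv_lt_one_of_one_lt₀ hb)).mul_left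
    (3 * b⁻¹)
  have h1 : b - 1 ≠ 0 := by linarith
  have h2 : b ≠ 0 := by linarith
  have h3 : (3 : ℝ) / (b - 1) = 3 * b⁻¹ * (1 - b⁻¹)⁻¹ := by
    rw [show 1 - b⁻¹ = (b - 1) / b by field_simp, inv_div]
    field_simp
  rwa [h3]

theorem abs_tailValue_le (a : ℕ → Letter) {β : ℝ} (hβ : 1 < β) (n : ℕ) :
    |tailValue a β n| ≤ 3 / (β - 1) :=
  tsum_of_norm_bounded (hasSum_three_mul_inv_geometric hβ)
    (norm_tailValue_term_le a (by linarith) le_rfl n)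

theorem mul_tailValue (a : ℕ → Letter) {β : ℝ} (hβ : 1 < β) (n : ℕ) :
    β * tailValue a β n = -((a n).val + tailValue a β (n + 1)) := by
  have hs : Summable fun k => ((a (n + k)).val : ℝ) * (-β⁻¹) ^ (k + 1) :=
    Summable.of_norm_bounded (hasSum_three_mul_inv_geometric hβ).summable
      (norm_tailValue_term_le a (by linarith) le_rfl n)
  have h0 : β ≠ 0 := by linarith
  have h1 : tailValue a β n = (a n).val * (-β⁻¹) + tailValue a β (n + 1) * (-β⁻¹) := by
    unfold tailValue
    rw [hs.tsum_eq_zero_add, ← tsum_mul_right]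
    congr 1
    · simp
    · refine tsum_congr fun k => ?_
      rw [pow_succ _ (k + 1), ← mul_assoc, show n + (k + 1) = n + 1 + k by ring]
  rw [h1]
  field_simp
  ring

theorem continuousOn_tailValue (a : ℕ → Letter) {b : ℝ} (hb : 1 < b) (n : ℕ) :
    ContinuousOn (fun β => tailValue a β n) (Set.Ici b) := by
  refine continuousOn_tsum (fun k => ?_) (hasSum_three_mul_inv_geometric hb).summable
    (fun k β h => norm_tailValue_term_le a (by linarith) h n k)
  refine continuousOn_const.mul (ContinuousOn.pow (ContinuousOn.neg ?_) _)
  refine continuousOn_inv₀.mono fun β h => ?_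
  have : b ≤ β := h
  exact ne_of_gt (by linarith)

/-- The numbers `t n` are the values in base `-β` of the tails of `a`, and the value of `a` is the left
endpoint of the domain. -/
structure IsTails (a : ℕ → Letter) (β : ℝ) (t : ℕ → ℝ) : Prop where
  ge : 18 / 5 ≤ β
  le : β ≤ 4
  mul : ∀ n, β * t n = -((a n).val + t (n + 1))
  abs_le : ∀ n, |t n| ≤ 6 / 5
  zero : t 0 = leftEnd β

theorem IsRuler.exists_isTails {a : ℕ → Letter} (ha : IsRuler a) : ∃ β t, IsTails a β t := by
  have a1 : a 1 = .zero := ha.zeros 0 0 (by norm_num)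
  have a2 : a 2 = .zero := ha.zeros 0 1 (by norm_num)
  have a3 : a 3 = .three := (ha.copy 0 0 (by decide)).trans ha.head
  have hbd : ∀ β : ℝ, 18 / 5 ≤ β → ∀ n, |tailValue a β n| ≤ 6 / 5 := fun β h n =>
    -- At `β = 18/5` the bound `3 / (β - 1)` is 15/13, below 6/5.
    (abs_tailValue_le a (by linarith) n).trans (by rw [div_le_iff₀] <;> linarith)
  have hstart : ∀ β : ℝ, 18 / 5 ≤ β → β * tailValue a β 0 = -(3 + tailValue a β 1) ∧
      β * tailValue a β 1 = -tailValue a β 2 ∧ β * tailValue a β 2 = -tailValue a β 3 ∧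
      β * tailValue a β 3 = -(3 + tailValue a β 4) := by
    intro β h
    have hm := mul_tailValue a (show 1 < β by linarith)
    have m0 := hm 0
    have m1 := hm 1
    have m2 := hm 2
    have m3 := hm 3
    simp only [ha.head, a1, a2, a3, Letter.val] at m0 m1 m2 m3
    norm_num at m0 m1 m2 m3
    exact ⟨by linarith, by linarith, by linarith, by linarith⟩
  have hc : ContinuousOn (fun β => tailValue a β 0 - leftEnd β) (Set.Icc (18 / 5) 4) := by
    refine ((continuousOn_tailValue a (b := 18 / 5) (by norm_num) 0).mono fun x hx => hx.1).sub ?_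
    unfold leftEnd
    refine ContinuousOn.div (by fun_prop) (by fun_prop) fun x hx => ?_
    have := hx.1
    exact ne_of_gt (by linarith)
  have hlow : tailValue a (18 / 5) 0 - leftEnd (18 / 5) ≤ 0 := by
    obtain ⟨m0, m1, m2, m3⟩ := hstart (18 / 5) le_rfl
    have := abs_le.mp (hbd (18 / 5) le_rfl 4)
    norm_num [leftEnd]
    linarith
  have hhigh : 0 ≤ tailValue a 4 0 - leftEnd 4 := by
    obtain ⟨m0, m1, m2, m3⟩ := hstart 4 (by norm_num)
    have := abs_le.mp (hbd 4 (by norm_num) 4)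
    norm_num [leftEnd]
    linarith
  obtain ⟨β, hβ, h⟩ := intermediate_value_Icc (by norm_num) hc ⟨hlow, hhigh⟩
  exact ⟨β, tailValue a β, hβ.1, hβ.2, fun n => mul_tailValue a (by linarith [hβ.1]) n,
    hbd β hβ.1, sub_eq_zero.mp h⟩

theorem leftEnd_eq {β : ℝ} (hβ : 1 < β) : leftEnd β = 1 / (β + 1) - 1 := by
  unfold leftEnd
  have : β + 1 ≠ 0 := by linarith
  field_simp
  ring

theorem div_add_one_eq {β : ℝ} (hβ : 1 < β) : β / (β + 1) = 1 - 1 / (β + 1) := by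
  have : β + 1 ≠ 0 := by linarith
  field_simp
  ring

theorem mem_domain_iff {β x : ℝ} : x ∈ domain β ↔ leftEnd β ≤ x ∧ x < 1 / (β + 1) := Iff.rfl

namespace IsTails

variable {a : ℕ → Letter} {β : ℝ} {t : ℕ → ℝ}

theorem one_lt (h : IsTails a β t) : 1 < β := by linarith [h.ge]

theorem le_third (h : IsTails a β t) (n : ℕ) : t n ≤ 1 / 3 := by
  have h1 := h.mul n
  have h2 := h.mul (n + 1)
  have h3 := (a n).val_nonneg
  have h4 := (a (n + 1)).val_le_three
  have h5 := _root_.abs_le.mp (h.abs_le (n + 2))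
  have h6 : -(7 / 6) ≤ t (n + 1) := by
    by_contra! hc
    nlinarith [h.ge]
  by_contra! hc
  nlinarith [h.ge]

theorem mul_of_zero (h : IsTails a β t) {n : ℕ} (hn : a n = .zero) : β * t n = -t (n + 1) := by
  have := h.mul n
  rw [hn] at this
  simpa [Letter.val] using this

theorem le_of_ne_zero (h : IsTails a β t) {n : ℕ} (hn : a n ≠ .zero) : t n ≤ -(1 / 5) := by
  have h1 := h.mul n
  have h2 : (2 : ℝ) ≤ (a n).val := by
    cases hx : a n
    · exact absurd hx hn
    · norm_num [Letter.val]
    · norm_num [Letter.val]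
  have h5 := _root_.abs_le.mp (h.abs_le (n + 1))
  by_contra! hc
  nlinarith [h.ge, h.le]

theorem ge_of_zero (h : IsTails a β t) {n : ℕ} (hn : a n = .zero) : -(1 / 10) ≤ t n := by
  have h1 := h.mul_of_zero hn
  have h2 := h.le_third (n + 1)
  by_contra! hc
  nlinarith [h.ge]

/-- With `leftEnd_le`, this separates tails not starting with `3` from the left endpoint by 3/4 -
13/20 = 1/10, the constant in the gap estimates. -/
theorem ge_of_ne_three (h : IsTails a β t) {n : ℕ} (hn : a n ≠ .three) : -(13 / 20) ≤ t n := by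
  have h1 := h.mul n
  have h2 : ((a n).val : ℝ) ≤ 2 := by
    cases hx : a n
    · norm_num [Letter.val]
    · norm_num [Letter.val]
    · exact absurd hx hn
  have h3 := h.le_third (n + 1)
  by_contra! hc
  nlinarith [h.ge]

theorem pow_mul_sub (h : IsTails a β t) {m n M : ℕ} (hM : ∀ i < M, a (n + i) = a (m + i)) :
    (-β) ^ M * (t n - t m) = t (n + M) - t (m + M) := by
  induction M with
  | zero => simp
  | succ M ih =>
    rw [pow_succ', mul_assoc, ih fun i hi => hM i (by omega)]
    have h1 := h.mul (n + M)
    have h2 := h.mul (m + M)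
    rw [hM M (by omega)] at h1
    rw [← Nat.add_assoc, ← Nat.add_assoc]
    linarith

theorem pow_mul_of_zeros (h : IsTails a β t) {n R : ℕ} (hR : ∀ i < R, a (n + i) = .zero) :
    (-β) ^ R * t n = t (n + R) := by
  induction R with
  | zero => simp
  | succ R ih =>
    rw [pow_succ', mul_assoc, ih fun i hi => hR i (by omega)]
    have h1 := h.mul_of_zero (hR R (by omega))
    rw [← Nat.add_assoc]
    linarith

theorem leftEnd_le (h : IsTails a β t) : leftEnd β ≤ -(3 / 4) := by
  rw [leftEnd_eq h.one_lt]
  have : 1 / (β + 1) ≤ 1 / 4 := one_div_le_one_div_of_le (by norm_num) (by linarith [h.ge])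
  linarith

theorem leftEnd_lt (ha : IsRuler a) (h : IsTails a β t) {n : ℕ} (hn : n ≠ 0) :
    leftEnd β < t n := by
  by_cases h3 : a n = .three
  · obtain ⟨M, hM, h1, h2, h4⟩ := ha.exists_odd_agreement hn h3
    have h5 := h.pow_mul_sub (m := 0) (n := n) (M := M) (by simpa using h1)
    rw [Odd.neg_pow (Nat.odd_iff.mpr hM), h.zero, Nat.zero_add] at h5
    have h6 := h.ge_of_zero h4
    have h7 := h.le_of_ne_zero (n := n + M) (by rw [h2]; exact fun hc => by cases hc)
    have h8 : 0 < β ^ M := pow_pos (by linarith [h.one_lt]) M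
    by_contra! hc
    nlinarith
  · linarith [h.ge_of_ne_three h3, h.leftEnd_le]

theorem mem_domain (ha : IsRuler a) (h : IsTails a β t) (n : ℕ) : t n ∈ domain β := by
  rw [mem_domain_iff]
  have hr : 0 < 1 / (β + 1) := by have := h.one_lt; positivity
  constructor
  · rcases Nat.eq_zero_or_pos n with rfl | hn
    · exact h.zero.ge
    · exact (h.leftEnd_lt ha hn.ne').le
  · by_cases h0 : a n = .zero
    · have h1 := h.mul_of_zero h0
      have h2 := h.leftEnd_lt ha (Nat.succ_ne_zero n)
      have h3 : leftEnd β = -(β * (1 / (β + 1))) := by unfold leftEnd; ring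
      have h4 : β * t n < β * (1 / (β + 1)) := by linarith
      exact lt_of_mul_lt_mul_left h4 (by linarith [h.one_lt])
    · linarith [h.le_of_ne_zero h0]

/-- The floor's argument is `a n + t (n+1) + β/(β+1)`, so this is membership of `t (n+1)` in the
domain. -/
theorem floor_eq (ha : IsRuler a) (h : IsTails a β t) (n : ℕ) :
    ⌊β / (β + 1) - β * t n⌋ = (a n).val := by
  rw [Int.floor_eq_iff, h.mul n, div_add_one_eq h.one_lt]
  have h1 := mem_domain_iff.mp (h.mem_domain ha (n + 1))
  rw [leftEnd_eq h.one_lt] at h1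
  constructor <;> linarith

theorem iterate_eq (ha : IsRuler a) (h : IsTails a β t) (n : ℕ) :
    (T β)^[n] (leftEnd β) = t n := by
  induction n with
  | zero => exact h.zero.symm
  | succ n ih =>
    rw [Function.iterate_succ_apply', ih, T, h.floor_eq ha]
    linarith [h.mul n]

theorem expansion_eq (ha : IsRuler a) (h : IsTails a β t) (n : ℕ) :
    expansion β (leftEnd β) n = (a n).val := by
  rw [expansion, h.iterate_eq ha, h.floor_eq ha]

theorem ne_zero (ha : IsRuler a) (h : IsTails a β t) (n : ℕ) : t n ≠ 0 := by
  intro hn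
  by_cases h0 : a n = .zero
  · obtain ⟨R, h1, h2⟩ := ha.exists_zeros_then_three h0
    have h3 := h.pow_mul_of_zeros h1
    have h4 := h.le_of_ne_zero (n := n + R) (by rw [h2]; exact fun hc => by cases hc)
    rw [hn, mul_zero] at h3
    linarith
  · linarith [h.le_of_ne_zero h0]

theorem exists_mem_positiveOddOrbit_lt (ha : IsRuler a) (h : IsTails a β t) {ε : ℝ} (hε : 0 < ε) :
    ∃ x ∈ positiveOddOrbit β, x < ε := by
  obtain ⟨k, hk⟩ := pow_unbounded_of_one_lt (2 / ε) h.one_lt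
  obtain ⟨m, R, hm, hR, hkR, h1, h2⟩ := ha.exists_odd_zeros_then_three k
  have h3 := h.pow_mul_of_zeros h1
  have h4 := h.le_of_ne_zero (n := m + R) (by rw [h2]; exact fun hc => by cases hc)
  have h5 := _root_.abs_le.mp (h.abs_le (m + R))
  rw [Odd.neg_pow (Nat.odd_iff.mpr hR)] at h3
  have h6 : β ^ k ≤ β ^ R := pow_le_pow_right₀ h.one_lt.le hkR.le
  have h7 : 0 < β ^ R := pow_pos (by linarith [h.one_lt]) R
  refine ⟨t m, ⟨?_, (m + 1) / 2, by omega, ?_⟩, ?_⟩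
  · by_contra! hc
    nlinarith
  · rw [h.iterate_eq ha]
    congr 1; omega
  · have h8 : 2 < β ^ R * ε := by
      rw [← div_lt_iff₀ hε]; linarith
    by_contra! hc
    nlinarith

theorem isGLB_positiveOddOrbit (ha : IsRuler a) (h : IsTails a β t) :
    IsGLB (positiveOddOrbit β) 0 := by
  refine ⟨fun x hx => hx.1.le, fun b hb => ?_⟩
  by_contra! hc
  obtain ⟨x, hx, hxb⟩ := h.exists_mem_positiveOddOrbit_lt ha hc
  exact absurd (hb hx) (not_le.mpr hxb)

theorem accPt_positiveOddOrbit (ha : IsRuler a) (h : IsTails a β t) :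
    AccPt (0 : ℝ) (Filter.principal (positiveOddOrbit β)) := by
  rw [accPt_iff_nhds]
  intro U hU
  obtain ⟨ε, hε, hU⟩ := Metric.mem_nhds_iff.mp hU
  obtain ⟨x, hx, hxε⟩ := h.exists_mem_positiveOddOrbit_lt ha hε
  refine ⟨x, ⟨hU ?_, hx⟩, hx.1.ne'⟩
  rw [Metric.mem_ball, dist_zero_right, Real.norm_of_nonneg hx.1.le]
  exact hxε

end IsTails

end NegBeta

/-! ### Gaps between preimages of zero, and uniform discreteness -/

namespace NegBeta

/-- The first digit of the `(-β)`-expansion of `x`. -/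
noncomputable def digit (β x : ℝ) : ℤ := ⌊β / (β + 1) - β * x⌋

theorem T_eq (β x : ℝ) : T β x = -β * x - digit β x := rfl

theorem digit_nonneg {β x : ℝ} (hβ : 1 < β) (hx : x ∈ domain β) : 0 ≤ digit β x := by
  refine Int.floor_nonneg.mpr ?_
  have h1 : β * x ≤ β * (1 / (β + 1)) := mul_le_mul_of_nonneg_left hx.2.le (by linarith)
  have h2 : β * (1 / (β + 1)) = β / (β + 1) := by ring
  linarith

theorem iterate_mem_domain {β x : ℝ} (hβ : 1 < β) (hx : x ∈ domain β) (n : ℕ) :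
    (T β)^[n] x ∈ domain β := (T_mapsTo hβ).iterate n hx

/-- If `x ≤ y` have different first digits, then the digit of `x` is the larger one, and the gap is at
least that between the image of `x` and the left endpoint, divided by `β`. -/
theorem image_sub_leftEnd_le {β x y : ℝ} (hβ : 1 < β) (hx : x ∈ domain β) (hy : y ∈ domain β)
    (hxy : x ≤ y) (hd : digit β x ≠ digit β y) :
    digit β y + 1 ≤ digit β x ∧ T β x - leftEnd β ≤ β * (y - x) := by
  have h1 := mem_domain_iff.mp (T_mapsTo hβ hx)
  have h2 := mem_domain_iff.mp (T_mapsTo hβ hy)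
  have h3 := T_eq β x
  have h4 := T_eq β y
  have h5 := leftEnd_eq hβ
  have h6 : 0 ≤ β * (y - x) := mul_nonneg (by linarith) (by linarith)
  have h7 : digit β y + 1 ≤ digit β x := by
    have h8 : (digit β y : ℝ) < digit β x + 1 := by linarith
    have h9 : digit β y < digit β x + 1 := by exact_mod_cast h8
    omega
  have h8 : (digit β y : ℝ) + 1 ≤ digit β x := by exact_mod_cast h7
  exact ⟨h7, by linarith⟩

theorem pow_mul_sub_of_digit_eq {β x y : ℝ} {L : ℕ}
    (h : ∀ i < L, digit β ((T β)^[i] x) = digit β ((T β)^[i] y)) :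
    (-β) ^ L * (x - y) = (T β)^[L] x - (T β)^[L] y := by
  induction L with
  | zero => simp
  | succ L ih =>
    rw [pow_succ', mul_assoc, ih fun i hi => h i (by omega), Function.iterate_succ_apply',
      Function.iterate_succ_apply', T_eq, T_eq, h L (by omega)]
    ring

namespace IsTails

variable {a : ℕ → Letter} {β : ℝ} {t : ℕ → ℝ}

theorem digit_iterate (ha : IsRuler a) (h : IsTails a β t) (n : ℕ) :
    digit β ((T β)^[n] (leftEnd β)) = (a n).val := h.expansion_eq ha n

theorem le_of_digits_eq (ha : IsRuler a) (h : IsTails a β t) {k : ℕ} {z : ℝ} (hz : z ∈ domain β)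
    (hk : (T β)^[k] z = 0) (hd : ∀ i < k, digit β ((T β)^[i] z) = (a i).val) :
    1 / 10 ≤ β ^ k * (z - leftEnd β) := by
  have hβ := h.one_lt
  have hpos : ∀ n, 0 < β ^ n := pow_pos (by linarith)
  have hneg : ∀ n, a n = .three → t n < 0 := fun n hn => by
    linarith [h.le_of_ne_zero (n := n) (by rw [hn]; exact fun hc => by cases hc)]
  have h1 : (-β) ^ k * (z - leftEnd β) = -t k := by
    rw [pow_mul_sub_of_digit_eq fun i hi => (hd i hi).trans (h.digit_iterate ha i).symm, hk,
      h.iterate_eq ha, zero_sub]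
  have h2 := (mem_domain_iff.mp hz).1
  by_cases h0 : a k = .zero
  · exfalso
    obtain ⟨R, hR, h3⟩ := ha.exists_zeros_then_three h0
    have h4 : (-β) ^ (k + R) * (z - leftEnd β) = -t (k + R) := by
      rw [pow_add, mul_comm ((-β) ^ k), mul_assoc, h1, mul_neg, h.pow_mul_of_zeros hR]
    have hR0 : R ≠ 0 := by
      rintro rfl
      rw [Nat.add_zero, h0] at h3
      cases h3
    have h5 := hneg _ h3
    have heven : (k + R) % 2 = 0 := by
      by_contra hc
      rw [Odd.neg_pow (Nat.odd_iff.mpr (by omega))] at h4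
      nlinarith [hpos (k + R)]
    obtain ⟨q, hq, hqo, hcopy⟩ := ha.exists_odd_copy (by omega) heven h3
    have hqk : q < k := by
      by_contra! hc
      have h6 := hR (q - k) (by omega)
      have h7 := hcopy 0 hq.le
      rw [show k + (q - k) = q + 0 by omega, h7, ha.head] at h6
      cases h6
    have hy := iterate_mem_domain hβ hz q
    have h6 : (-β) ^ (k - q) * ((T β)^[q] z - leftEnd β) = -t (k - q) := by
      rw [pow_mul_sub_of_digit_eq, h.iterate_eq ha, ← Function.iterate_add_apply,
        Nat.sub_add_cancel hqk.le, hk, zero_sub]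
      intro i hi
      rw [← Function.iterate_add_apply, h.digit_iterate ha, hd _ (by omega), Nat.add_comm,
        hcopy i (by omega)]
    have h7 : (-β) ^ R * t (k - q) = t (k - q + R) := by
      refine h.pow_mul_of_zeros fun i hi => ?_
      rw [← hcopy _ (by omega), ← hR i hi]
      congr 1; omega
    have h8 : a (k - q + R) = .three := by
      rw [← hcopy _ (by omega), ← h3]
      congr 1; omega
    have h9 : (-β) ^ (k - q + R) * ((T β)^[q] z - leftEnd β) = -t (k - q + R) := by
      rw [pow_add, mul_comm ((-β) ^ (k - q)), mul_assoc, h6, mul_neg, h7]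
    rw [Odd.neg_pow (Nat.odd_iff.mpr (by omega))] at h9
    have := hneg _ h8
    have := (mem_domain_iff.mp hy).1
    nlinarith [hpos (k - q + R)]
  · have h3 := h.le_of_ne_zero h0
    rcases Nat.even_or_odd k with hk | hk
    · rw [hk.neg_pow] at h1
      linarith
    · rw [hk.neg_pow] at h1
      nlinarith [hpos k]

theorem le_pow_mul_sub_leftEnd (ha : IsRuler a) (h : IsTails a β t) (k : ℕ) :
    ∀ z ∈ domain β, (T β)^[k] z = 0 → 1 / 10 ≤ β ^ k * (z - leftEnd β) := by
  induction k using Nat.strong_induction_on with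
  | _ k ih =>
  intro z hz hk
  have hβ := h.one_lt
  by_cases hd : ∀ i < k, digit β ((T β)^[i] z) = (a i).val
  · exact h.le_of_digits_eq ha hz hk hd
  push Not at hd
  classical
  obtain ⟨hLk, hL⟩ := Nat.find_spec hd
  have hmin : ∀ i < Nat.find hd, digit β ((T β)^[i] z) = (a i).val := fun i hi => by
    by_contra hc
    exact Nat.find_min hd hi ⟨hi.trans hLk, hc⟩
  generalize Nat.find hd = L at hLk hL hmin
  have h1 : (-β) ^ L * (z - leftEnd β) = (T β)^[L] z - t L := by
    rw [pow_mul_sub_of_digit_eq fun i hi => (hmin i hi).trans (h.digit_iterate ha i).symm,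
      h.iterate_eq ha]
  have h2 := (mem_domain_iff.mp hz).1
  have hpos : 0 < β ^ L := pow_pos (by linarith) L
  have hzL := iterate_mem_domain hβ hz L
  have htL := h.mem_domain ha L
  have hdt : digit β (t L) = (a L).val := h.floor_eq ha L
  have hTt : T β (t L) = t (L + 1) := by
    rw [← h.iterate_eq ha, ← h.iterate_eq ha, Function.iterate_succ_apply']
  have hsplit : β ^ k = β ^ (k - (L + 1)) * (β * β ^ L) := by
    rw [← pow_succ', ← pow_add]
    congr 1; omega
  have hk1 : 1 ≤ β ^ (k - (L + 1)) := one_le_pow₀ hβ.le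
  rcases Nat.even_or_odd L with hp | hp
  -- For even `L`, `z` has the smaller digit, so `a L` is nonzero and `a (L+1)` is not `3`: the gap
  -- is at least 1/10. For odd `L` the roles swap and the induction applies to `T^(L+1) z`.
  · rw [hp.neg_pow] at h1
    obtain ⟨h3, h4⟩ := image_sub_leftEnd_le hβ htL hzL (by nlinarith)
      (by rw [hdt]; exact hL.symm)
    have h5 := digit_nonneg hβ hzL
    have h6 : a (L + 1) ≠ .three := fun hc => by
      rw [hdt, ha.eq_zero_of_succ_eq_three hc] at h3
      simp only [Letter.val] at h3
      omega
    have h7 := h.ge_of_ne_three h6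
    have h8 := h.leftEnd_le
    rw [hTt, ← h1] at h4
    rw [hsplit, mul_assoc, mul_assoc]
    nlinarith
  · rw [hp.neg_pow] at h1
    obtain ⟨-, h4⟩ := image_sub_leftEnd_le hβ hzL htL (by nlinarith) (by rw [hdt]; exact hL)
    rw [← Function.iterate_succ_apply' (T β)] at h4
    have h5 := ih (k - (L + 1)) (by omega) _ (iterate_mem_domain hβ hz (L + 1))
      (by rw [← Function.iterate_add_apply, Nat.sub_add_cancel hLk]; exact hk)
    rw [hsplit, mul_assoc]
    refine h5.trans (mul_le_mul_of_nonneg_left (h4.trans ?_) (by linarith))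
    rw [mul_assoc]
    exact mul_le_mul_of_nonneg_left (by linarith) (by linarith)

theorem le_pow_mul_sub (ha : IsRuler a) (h : IsTails a β t) (n : ℕ) :
    ∀ x ∈ domain β, ∀ y ∈ domain β, (T β)^[n] x = 0 → (T β)^[n] y = 0 → x < y →
      1 / 10 ≤ β ^ n * (y - x) := by
  have hβ := h.one_lt
  induction n with
  | zero =>
    intro x _ y _ hx0 hy0 hxy
    simp only [Function.iterate_zero, id] at hx0 hy0
    linarith
  | succ n ih =>
    intro x hx y hy hx0 hy0 hxy
    rw [Function.iterate_succ_apply] at hx0 hy0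
    rw [pow_succ, mul_assoc]
    by_cases hd : digit β x = digit β y
    · have h1 : β * (y - x) = T β x - T β y := by
        rw [T_eq, T_eq, hd]; ring
      rw [h1]
      have h2 : 0 < β * (y - x) := mul_pos (by linarith) (by linarith)
      exact ih _ (T_mapsTo hβ hy) _ (T_mapsTo hβ hx) hy0 hx0 (by linarith)
    · exact (h.le_pow_mul_sub_leftEnd ha n _ (T_mapsTo hβ hx) hx0).trans
        (mul_le_mul_of_nonneg_left (image_sub_leftEnd_le hβ hx hy hxy.le hd).2
          (pow_nonneg (by linarith) n))

/-- The scaled preimages of `0` whose union is the set of `(-β)`-integers increase. -/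
theorem monotone_scaled_preimage (ha : IsRuler a) (h : IsTails a β t) :
    Monotone fun n : ℕ =>
      (fun y : ℝ => (-β) ^ n * y) '' {y | y ∈ domain β ∧ (T β)^[n] y = 0} := by
  have hβ := h.one_lt
  have hβ0 : β ≠ 0 := by linarith
  refine monotone_nat_of_le_succ fun n => ?_
  rintro _ ⟨y, ⟨hy, hy0⟩, rfl⟩
  -- The preimage `-y/β` of `y` with digit 0 lies in the domain unless `y` is the left endpoint,
  -- whose orbit avoids 0.
  have hne : y ≠ leftEnd β := by
    rintro rfl
    exact h.ne_zero ha n ((h.iterate_eq ha n).symm.trans hy0)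
  obtain ⟨h1, h2⟩ := mem_domain_iff.mp hy
  have h3 : leftEnd β < y := lt_of_le_of_ne h1 hne.symm
  have h4 : β * (1 / (β + 1)) = -leftEnd β := by unfold leftEnd; ring
  have h5 := leftEnd_eq hβ
  have h6 : β * (-y / β) = -y := by field_simp
  have h7 := h.leftEnd_le
  have hT : T β (-y / β) = y := by
    have : ⌊β / (β + 1) - β * (-y / β)⌋ = 0 := by
      rw [Int.floor_eq_zero_iff, h6, div_add_one_eq hβ]
      constructor <;> linarith
    rw [T, this, neg_mul, h6]
    simp
  refine ⟨-y / β, ⟨mem_domain_iff.mpr ⟨?_, ?_⟩, ?_⟩, ?_⟩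
  · by_contra! hc
    nlinarith
  · by_contra! hc
    nlinarith
  · rw [Function.iterate_succ_apply, hT, hy0]
  · simp only
    rw [pow_succ, mul_assoc, neg_mul, h6, neg_neg]

theorem uniformlyDiscrete_negBetaIntegers (ha : IsRuler a) (h : IsTails a β t) :
    UniformlyDiscrete (negBetaIntegers β) := by
  have hβ := h.one_lt
  have hmono := h.monotone_scaled_preimage ha
  refine ⟨1 / 20, by norm_num, fun x u hu v hv => ?_⟩
  obtain ⟨hu, hu1, hu2⟩ := hu
  obtain ⟨hv, hv1, hv2⟩ := hv
  obtain ⟨m, hm⟩ := Set.mem_iUnion.mp hu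
  obtain ⟨n, hn⟩ := Set.mem_iUnion.mp hv
  obtain ⟨y, ⟨hy, hy0⟩, rfl⟩ := hmono (le_max_left m n) hm
  obtain ⟨z, ⟨hz, hz0⟩, rfl⟩ := hmono (le_max_right m n) hn
  have key : |(-β) ^ max m n * (y - z)| ≤ 1 / 20 := by
    rw [mul_sub, _root_.abs_le]
    constructor <;> linarith
  rw [abs_mul, abs_pow, abs_neg, abs_of_pos (by linarith : 0 < β)] at key
  rcases lt_trichotomy y z with hyz | rfl | hyz
  · have := h.le_pow_mul_sub ha _ y hy z hz hy0 hz0 hyz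
    rw [abs_sub_comm, abs_of_pos (sub_pos.mpr hyz)] at key
    linarith
  · rfl
  · have := h.le_pow_mul_sub ha _ z hz y hy hz0 hy0 hyz
    rw [abs_of_pos (sub_pos.mpr hyz)] at key
    linarith

end IsTails

end NegBeta

theorem mainTheorem5 :
    (∃! a : ℕ → NegBeta.Letter, a 0 = NegBeta.Letter.three ∧ NegBeta.IsFixedPoint a) ∧
    ∀ a : ℕ → NegBeta.Letter, a 0 = NegBeta.Letter.three → NegBeta.IsFixedPoint a →
      ∃ β : ℝ, 1 < β ∧
        (∀ n : ℕ, NegBeta.expansion β (NegBeta.leftEnd β) n = (a n).val) ∧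
        IsGLB (NegBeta.positiveOddOrbit β) 0 ∧
        AccPt (0 : ℝ) (Filter.principal (NegBeta.positiveOddOrbit β)) ∧
        NegBeta.UniformlyDiscrete (NegBeta.negBetaIntegers β) := by
  refine ⟨NegBeta.existsUnique_fixedPoint, fun a h0 hfix => ?_⟩
  have ha := hfix.isRuler h0
  obtain ⟨β, t, h⟩ := ha.exists_isTails
  exact ⟨β, h.one_lt, h.expansion_eq ha, h.isGLB_positiveOddOrbit ha,
    h.accPt_positiveOddOrbit ha, h.uniformlyDiscrete_negBetaIntegers ha⟩
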